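/- Let $T$ be a finite rooted tree that is pure, i.e. all its leaves are at the same depth. Let $L$ be its set of leaves, $I$ its set of inner (non-leaf) nodes, and $C_x$ the set of children of $x\in I$. Every node counts as a descendant of itself; for $E\subseteq L$, a node is called $E$-related if some descendant of it belongs to $E$. A local ordering of $T$ is a family $\pi=(\pi_x)_{x\in I}$ of linear orderings $\pi_x$ of the sets $C_x$; let $\mathcal O(T)$ be the set of all local orderings. For $E\subseteq L$ and $\pi\in\mathcal O(T)$ let $E(\pi)\in\mathcal O(T)$ be the local ordering in which, at each $x\in I$, the $E$-related elements of $C_x$ come first, in the order induced by $\pi_x$, followed by the remaining elements of $C_x$, also in the induced order. Let $\mathrm{Part}(T)=\bigotimes_{x\in I}\Pi(C_x)$, where $\Pi(A)$ is the set of partitions of $A$. For $E\subseteq L$ and $x\in I$ let $\alpha^E_x$ be the partition of $C_x$ into the block of $E$-related elements and the block of remaining elements (an empty block being dropped). A set $E\subseteq L$ is $\alpha$-compatible, for $\alpha=(\alpha_x)_{x\in I}\in\mathrm{Part}(T)$, if for every $x\in I$ each block of $\alpha_x$ is contained in a block of $\alpha^E_x$. Let $(w_E)_{E\subseteq L}$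 be a probability distribution on $2^L$, and let $P_w$ be the real $\mathcal O(T)\times\mathcal O(T)$ matrix $$P_w(\pi,\pi')=\sum_{E:\,E(\pi)=\pi'}w_E .$$ For $\alpha\in\mathrm{Part}(T)$ put $$\varepsilon_\alpha=\sum_{E:\,E\text{ is }\alpha\text{-compatible}}w_E,\qquad m_\alpha=\prod_{x\in I}\prod_{B\in\alpha_x}(|B|-1)!.$$ Then: (i) $P_w$ is diagonalizable (over $\mathbb R$). (ii) For each $\alpha\in\mathrm{Part}(T)$, $\varepsilon_\alpha$ is an eigenvalue of $P_w$. (iii) The eigenvalue $\varepsilon_\alpha$ occurs with multiplicity $m_\alpha$, where the multiplicities are added up when $\varepsilon_\alpha=\varepsilon_\beta$ for different $\alpha,\beta$; that is, the characteristic polynomial of $P_w$ is $\prod_{\alpha\in\mathrm{Part}(T)}(X-\varepsilon_\alpha)^{m_\alpha}$, and for every real $c$ the eigenspace of $P_w$ for $c$ has dimension $\sum_{\alpha:\,\varepsilon_\alpha=c}m_\alpha$. (iv) These are all the eigenvalues: every complex eigenvalue of $P_w$ equals $\varepsilon_\alpha$ for some $\alpha\in\mathrm{Part}(T)$. -/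

import Mathlib

open scoped Classical

/-- A square matrix over a field is diagonalizable if it is conjugate, over that field, to a
diagonal matrix. -/
def Matrix.Diagonalizable {n K : Type*} [Fintype n] [Field K] (A : Matrix n n K) : Prop :=
  ∃ (S : (Matrix n n K)ˣ) (d : n → K),
    A = (S : Matrix n n K) * Matrix.diagonal d * ((S⁻¹ : (Matrix n n K)ˣ) : Matrix n n K)

namespace TreeShuffle

/-- The linear orderings of `A`, as strict order relations; `r a b` means that `a` stands
before `b`. -/
def LinOrd (A : Type*) : Type _ := {r : A → A → Prop // IsStrictTotalOrder A r}

instance {A : Type*} [Finite A] : Finite (LinOrd A) := Subtype.finite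

/-- Move the elements satisfying `R` to the front, keeping the induced order among the elements
satisfying `R` and among the remaining ones. -/
def LinOrd.toFront {A : Type*} (R : A → Prop) (r : LinOrd A) : LinOrd A :=
  ⟨fun a b => (R a ∧ ¬ R b) ∨ ((R a ↔ R b) ∧ r.1 a b), by
    have := r.2
    have hirr : ∀ a, ¬ r.1 a a := fun a => Std.Irrefl.irrefl a
    have htr : ∀ a b c, r.1 a b → r.1 b c → r.1 a c := fun a b c => IsTrans.trans a b c
    have htri : ∀ a b, ¬ r.1 a b → ¬ r.1 b a → a = b := fun a b =>
      Std.Trichotomous.trichotomous a b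
    exact
      { trichotomous := fun a b h1 h2 => htri a b (by tauto) (by tauto)
        irrefl := fun a => by
          have := hirr a
          tauto
        trans := fun a b c => by
          have := htr a b c
          tauto }⟩

/-! In a rooted tree the order is the ancestor order: the root is `⊥`, and `x ≤ y` means that
`y` is a descendant of `x` (every node being a descendant of itself). -/

/-- The leaves: the nodes without proper descendants. -/
def Leaf (T : RootedTree) : Type _ := {x : T // IsMax x}

/-- The inner nodes: the nodes that are not leaves. -/
def Inner (T : RootedTree) : Type _ := {x : T // ¬ IsMax x}

/-- The children of a node. -/
def Children {T : RootedTree} (x : T) : Type _ := {y : T // x ⋖ y}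

/-- All leaves are at the same depth. The depth of a node is its height in the ancestor order,
i.e. the length of the chain from the root to it. -/
def IsPure (T : RootedTree) : Prop :=
  ∃ d : ℕ, ∀ l : Leaf T, Order.height l.1 = d

noncomputable instance (T : RootedTree) [Finite T] : Fintype (Leaf T) :=
  have : Finite (Leaf T) := Subtype.finite
  Fintype.ofFinite _

noncomputable instance (T : RootedTree) [Finite T] : Fintype (Inner T) :=
  have : Finite (Inner T) := Subtype.finite
  Fintype.ofFinite _

noncomputable instance {T : RootedTree} [Finite T] (x : T) : Fintype (Children x) :=
  have : Finite (Children x) := Subtype.finite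
  Fintype.ofFinite _

/-- `x` is `E`-related if some descendant of `x` belongs to `E`. -/
def Related {T : RootedTree} (E : Finset (Leaf T)) (x : T) : Prop :=
  ∃ l ∈ E, x ≤ l.1

/-- A local ordering: a linear ordering of the children of each inner node. -/
def LocalOrdering (T : RootedTree) : Type _ := (x : Inner T) → LinOrd (Children x.1)

noncomputable instance (T : RootedTree) [Finite T] : Fintype (LocalOrdering T) :=
  have : Finite (LocalOrdering T) := Pi.finite
  Fintype.ofFinite _

/-- The action `π ↦ E(π)` of a set of leaves on local orderings. -/
def move {T : RootedTree} (E : Finset (Leaf T)) (π : LocalOrdering T) : LocalOrdering T :=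
  fun x => (π x).toFront fun y => Related E y.1

/-- The product of the partition lattices of the sets of children of the inner nodes. -/
abbrev TreePart (T : RootedTree) [Finite T] : Type _ :=
  (x : Inner T) → Finpartition (Finset.univ : Finset (Children x.1))

/-- The partition of the children of `x` into the `E`-related and the remaining ones, an empty
block being dropped. -/
noncomputable def inducedPartition {T : RootedTree} [Finite T] (E : Finset (Leaf T))
    (x : Inner T) : Finpartition (Finset.univ : Finset (Children x.1)) :=
  Finpartition.ofErase
    {Finset.univ.filter fun y => Related E y.1, Finset.univ.filter fun y => ¬ Related E y.1}
    (by
      rw [Finset.supIndep_iff_pairwiseDisjoint]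
      intro a ha b hb hab
      simp only [Finset.coe_insert, Finset.coe_singleton, Set.mem_insert_iff,
        Set.mem_singleton_iff] at ha hb
      rcases ha with rfl | rfl <;> rcases hb with rfl | rfl
      · exact absurd rfl hab
      · exact Finset.disjoint_filter_filter_not _ _ _
      · exact (Finset.disjoint_filter_filter_not _ _ _).symm
      · exact absurd rfl hab)
    (by
      ext y
      simp [em])

/-- `E` is `α`-compatible if each `α_x` refines the partition induced by `E` at `x`. (In the
order on `Finpartition`, `P ≤ Q` means that every block of `P` lies in a block of `Q`.) -/
def Compatible {T : RootedTree} [Finite T] (α : TreePart T) (E : Finset (Leaf T)) : Prop :=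
  ∀ x, α x ≤ inducedPartition E x

/-- The transition matrix of the random walk on local orderings driven by `w`. -/
noncomputable def transition {T : RootedTree} [Finite T] (w : Finset (Leaf T) → ℝ) :
    Matrix (LocalOrdering T) (LocalOrdering T) ℝ :=
  Matrix.of fun π π' => ∑ E with move E π = π', w E

/-- The number `ε_α`. -/
noncomputable def eigval {T : RootedTree} [Finite T] (w : Finset (Leaf T) → ℝ) (α : TreePart T) : ℝ :=
  ∑ E with Compatible α E, w E

/-- The number `m_α`. -/
noncomputable def mult {T : RootedTree} [Finite T] (α : TreePart T) : ℕ :=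
  ∏ x, ∏ B ∈ (α x).parts, (B.card - 1).factorial

end TreeShuffle

/-!
The move by a set `E` of leaves acts at each inner node on its own, bringing the `E`-related
children to the front. A composition of moves therefore sorts the children of every node by the
answers to the questions "related to `E` or not?", the last move being the most significant, and
keeps the given order among children with equal answers (`LinOrd.exists_code`). Two consequences
carry the proof; write `M_l` for the matrix of the composition of a list `l` of moves, so that
`P * M_l = ∑ E, w E • M_(E :: l)`.

*Diagonalizability.* If `l` determines `E`, that is, if the partitions induced by `l` separate all
the siblings that `E` separates, then `M_(E :: l) = M_l` (`moves_cons_of_determines`). With `λ_l`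
the total weight of the sets determined by `l`, the matrix `(P - λ_l) * M_l` is thus a combination
of the `M_(E :: l)` for sets `E` of positive weight that `l` does not determine, and for these
`λ_(E :: l) > λ_l`. Every `λ_l` is some `ε_α`, namely for `α` the common refinement of the partitions
induced by `l`. Multiplying `1 = M_[]` by the factors `P - c` for the distinct values `c` of `ε` in
increasing order gives `0` (`aeval_transition_mul_movesMatrix`). So `P` is annihilated by a
product of distinct linear factors.

*Multiplicities.* The trace of `M_l` counts the local orderings fixed by `l`. At each node, these
are the orderings along which the code increases, and there are as many of them as permutations of
the children preserving the code (`LinOrd.card_monotone`). Sorting these permutations by their orbit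
partition, and using that `∏ B, (|B| - 1)!` permutations have a given orbit partition, shows that
`tr M_l` is the sum of `m_α` over those `α` with which all members of `l` are compatible
(`card_fixed_moves`). By induction on `k` this yields `tr P ^ k = ∑ α, m_α * ε_α ^ k`, and these power
sums determine the multiplicities of the eigenvalues of the diagonalizable matrix `P`
(`card_filter_eq_sum_of_power_sums`).
-/

/-! ### Diagonalizability and multiplicities -/

open Polynomial in
/-- The kernel of a product of distinct linear factors is spanned by eigenvectors. -/
theorem Module.End.ker_aeval_prod_X_sub_C_le_iSup_eigenspace {K V : Type*} [Field K]
    [AddCommGroup V] [Module K V] (f : Module.End K V) (S : Finset K) :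
    LinearMap.ker (aeval f (∏ c ∈ S, (X - C c))) ≤ ⨆ c, f.eigenspace c := by
  induction S using Finset.induction_on with
  | empty =>
    intro v hv
    have : v = 0 := by simpa using hv
    simp [this]
  | insert c S hc ih =>
    rw [Finset.prod_insert hc, ← Polynomial.sup_ker_aeval_eq_ker_aeval_mul_of_coprime]
    · refine sup_le (le_trans ?_ (le_iSup _ c)) ih
      intro v hv
      simpa [Module.End.mem_eigenspace_iff, sub_eq_zero] using hv
    · refine IsCoprime.prod_right fun d hd => ?_
      exact Polynomial.isCoprime_X_sub_C_of_isUnit_sub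
        (sub_ne_zero.2 fun hcd => hc (by rwa [hcd])).isUnit

theorem Module.End.exists_basis_of_iSup_eigenspace_eq_top {n K V : Type*} [Field K]
    [AddCommGroup V] [Module K V] [FiniteDimensional K V] (f : Module.End K V)
    (b₁ : Module.Basis n K V) (h : ⨆ c, f.eigenspace c = ⊤) :
    ∃ (b : Module.Basis n K V) (d : n → K), ∀ i, f (b i) = d i • b i := by
  have hint : DirectSum.IsInternal f.eigenspace :=
    (DirectSum.isInternal_submodule_iff_iSupIndep_and_iSup_eq_top _).2
      ⟨f.eigenspaces_iSupIndep, h⟩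
  let b₀ := hint.collectedBasis fun c => Module.finBasis K (f.eigenspace c)
  have hb₀mem : ∀ j, f (b₀ j) = j.1 • b₀ j := fun j =>
    Module.End.mem_eigenspace_iff.1 (hint.collectedBasis_mem _ j)
  let e := b₀.indexEquiv b₁
  refine ⟨b₀.reindex e, fun i => (e.symm i).1, fun i => ?_⟩
  rw [Module.Basis.reindex_apply]
  exact hb₀mem _

open Polynomial in
theorem Matrix.diagonalizable_of_aeval_eq_zero {n K : Type*} [Fintype n] [Field K]
    (A : Matrix n n K) (S : Finset K) (h : aeval A (∏ c ∈ S, (X - C c)) = 0) :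
    A.Diagonalizable := by
  have htop : ⨆ c, Module.End.eigenspace (Matrix.toLin' A) c = ⊤ := by
    rw [eq_top_iff]
    refine le_trans ?_ (Module.End.ker_aeval_prod_X_sub_C_le_iSup_eigenspace _ S)
    have h0 : aeval (Matrix.toLin' A) (∏ c ∈ S, (X - C c)) = 0 := by
      have := aeval_algHom_apply (Matrix.toLinAlgEquiv' (R := K) (n := n)) A
        (∏ c ∈ S, (X - C c))
      rw [h, map_zero] at this
      exact this
    rw [h0, LinearMap.ker_zero]
  obtain ⟨b, d, hbd⟩ := Module.End.exists_basis_of_iSup_eigenspace_eq_top _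
    (Pi.basisFun K n) htop
  let T : (Matrix n n K)ˣ :=
    ⟨(Pi.basisFun K n).toMatrix b, b.toMatrix (Pi.basisFun K n),
      Module.Basis.toMatrix_mul_toMatrix_flip _ _, Module.Basis.toMatrix_mul_toMatrix_flip _ _⟩
  refine ⟨T, d, ?_⟩
  rw [Units.eq_mul_inv_iff_mul_eq]
  ext i j
  have hij := congrFun (hbd j) i
  rw [Matrix.mul_diagonal]
  have hT : ∀ k l, (T : Matrix n n K) k l = b l k := fun k l => by
    simp [T, Module.Basis.toMatrix_apply]
  simp only [Matrix.mul_apply, hT]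
  rw [mul_comm (b j i)]
  exact hij

open Polynomial in
/-- Power sums determine a weighted finite family of reals up to the total weight of each value. -/
theorem card_filter_eq_sum_of_power_sums {ι κ : Type*} [Fintype ι] [Fintype κ]
    (d : ι → ℝ) (e : κ → ℝ) (m : κ → ℕ)
    (h : ∀ k : ℕ, ∑ i, d i ^ k = ∑ j, (m j : ℝ) * e j ^ k) (c : ℝ) :
    (Finset.univ.filter fun i => d i = c).card = ∑ j with e j = c, m j := by
  have hp : ∀ p : ℝ[X], ∑ i, p.eval (d i) = ∑ j, (m j : ℝ) * p.eval (e j) := by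
    intro p
    simp only [eval_eq_sum_range, Finset.mul_sum]
    rw [Finset.sum_comm, Finset.sum_comm (s := (Finset.univ : Finset κ))]
    refine Finset.sum_congr rfl fun k _ => ?_
    rw [← Finset.mul_sum, h k, Finset.mul_sum]
    exact Finset.sum_congr rfl fun j _ => by ring
  let s : Finset ℝ := insert c (Finset.univ.image d ∪ Finset.univ.image e)
  have hc : c ∈ s := Finset.mem_insert_self _ _
  -- the Lagrange polynomial that is `1` at `c` and `0` at all other values
  have hev : ∀ x ∈ s, (Lagrange.basis s id c).eval x = if x = c then 1 else 0 := by
    intro x hx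
    split_ifs with hxc
    · subst hxc
      exact Lagrange.eval_basis_self (v := id) Function.injective_id.injOn hx
    · exact Lagrange.eval_basis_of_ne (v := id) (Ne.symm hxc) hx
  have h1 := hp (Lagrange.basis s id c)
  have hd : ∀ i, (Lagrange.basis s id c).eval (d i) = if d i = c then 1 else 0 :=
    fun i => hev _ (by simp [s])
  have he : ∀ j, (Lagrange.basis s id c).eval (e j) = if e j = c then 1 else 0 :=
    fun j => hev _ (by simp [s])
  simp only [hd, he] at h1
  simp only [mul_ite, mul_one, mul_zero, ← Finset.sum_filter] at h1
  rw [Finset.sum_const, nsmul_eq_mul, mul_one] at h1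
  exact_mod_cast h1

theorem Matrix.finrank_eigenspace_conj_diagonal {n K : Type*} [Fintype n] [Field K]
    (T : (Matrix n n K)ˣ) (d : n → K) (c : K) :
    Module.finrank K (Module.End.eigenspace (Matrix.toLin'
      ((T : Matrix n n K) * Matrix.diagonal d * ((T⁻¹ : (Matrix n n K)ˣ) : Matrix n n K))) c) =
      (Finset.univ.filter fun i => d i = c).card := by
  set A := (T : Matrix n n K) * Matrix.diagonal d * ((T⁻¹ : (Matrix n n K)ˣ) : Matrix n n K)
    with hA
  have hsub : A - algebraMap K _ c =
      (T : Matrix n n K) * Matrix.diagonal (fun i => d i - c) *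
        ((T⁻¹ : (Matrix n n K)ˣ) : Matrix n n K) := by
    have hdiag : Matrix.diagonal (fun i => d i - c) =
        Matrix.diagonal d - algebraMap K (Matrix n n K) c := by
      ext i j
      by_cases hij : i = j <;> simp [Matrix.algebraMap_matrix_apply, hij]
    rw [hdiag, mul_sub, sub_mul, ← hA, ← Algebra.commutes c (T : Matrix n n K), mul_assoc,
      Units.mul_inv, mul_one]
  have hrank : (A - algebraMap K _ c).rank = Fintype.card {i // d i - c ≠ 0} := by
    rw [hsub, Matrix.rank_mul_eq_left_of_isUnit_det _ _
        ((Matrix.isUnit_iff_isUnit_det _).1 (T⁻¹).isUnit),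
      Matrix.rank_mul_eq_right_of_isUnit_det _ _
        ((Matrix.isUnit_iff_isUnit_det _).1 T.isUnit), Matrix.rank_diagonal]
  have hker : Module.End.eigenspace (Matrix.toLin' A) c =
      LinearMap.ker (Matrix.toLin' (A - algebraMap K _ c)) := by
    rw [Module.End.eigenspace_def, map_sub]
    congr 2
    ext v
    simp [Algebra.algebraMap_eq_smul_one]
  have hrn := LinearMap.finrank_range_add_finrank_ker (Matrix.toLin' (A - algebraMap K _ c))
  rw [← hker, Module.finrank_fintype_fun_eq_card] at hrn
  have hr : Module.finrank K (LinearMap.range (Matrix.toLin' (A - algebraMap K _ c))) =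
      Fintype.card {i // d i - c ≠ 0} := hrank
  have hcard := Finset.card_filter_add_card_filter_not (s := (Finset.univ : Finset n))
    fun i => d i = c
  rw [Finset.card_univ] at hcard
  rw [hr, Fintype.card_subtype] at hrn
  simp only [sub_ne_zero] at hrn
  simp only [ne_eq] at hrn
  omega

theorem Matrix.charpoly_conj_diagonal {n K : Type*} [Fintype n] [Field K]
    (T : (Matrix n n K)ˣ) (d : n → K) :
    ((T : Matrix n n K) * Matrix.diagonal d *
      ((T⁻¹ : (Matrix n n K)ˣ) : Matrix n n K)).charpoly =
      ∏ i, (Polynomial.X - Polynomial.C (d i)) := by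
  rw [Matrix.charpoly_mul_comm, ← mul_assoc, Units.inv_mul, one_mul, Matrix.charpoly_diagonal]

theorem Matrix.trace_pow_conj_diagonal {n K : Type*} [Fintype n] [Field K]
    (T : (Matrix n n K)ˣ) (d : n → K) (k : ℕ) :
    (((T : Matrix n n K) * Matrix.diagonal d *
      ((T⁻¹ : (Matrix n n K)ˣ) : Matrix n n K)) ^ k).trace = ∑ i, d i ^ k := by
  rw [Units.conj_pow, Matrix.trace_units_conj, Matrix.diagonal_pow, Matrix.trace_diagonal]
  rfl

/-- A product over a family equals the weighted product over another one if each value has the same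
total weight in both. -/
theorem Finset.prod_eq_prod_pow_of_card_filter {ι κ R M : Type*} [Fintype ι] [Fintype κ]
    [CommMonoid M] (d : ι → R) (e : κ → R) (m : κ → ℕ)
    (h : ∀ c, (Finset.univ.filter fun i => d i = c).card = ∑ j with e j = c, m j) (g : R → M) :
    ∏ i, g (d i) = ∏ j, g (e j) ^ m j := by
  let s : Finset R := Finset.univ.image d ∪ Finset.univ.image e
  rw [← Finset.prod_fiberwise_of_maps_to (s := Finset.univ) (t := s) (g := d) (by simp [s]),
    ← Finset.prod_fiberwise_of_maps_to (s := Finset.univ) (t := s) (g := e) (by simp [s])]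
  refine Finset.prod_congr rfl fun c _ => ?_
  rw [Finset.prod_congr rfl (g := fun _ => g c) (by simp +contextual),
    Finset.prod_congr (s₁ := Finset.univ.filter fun j => e j = c) rfl
      (g := fun j => g c ^ m j) (by simp +contextual),
    Finset.prod_const, Finset.prod_pow_eq_pow_sum, h]

/-! ### Permutations with a given orbit partition -/

/-- A permutation of a nonempty type whose only orbit is the whole type is a full cycle. -/
theorem Equiv.Perm.card_transitive (A : Type*) [Fintype A] [Nonempty A] :
    Nat.card {σ : Equiv.Perm A // ∀ a b, σ.SameCycle a b} =
      (Fintype.card A - 1).factorial := by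
  rcases subsingleton_or_nontrivial A with hA | hA
  · have : Fintype.card A = 1 :=
      Fintype.card_eq_one_iff.2 ⟨Classical.arbitrary A, fun _ => Subsingleton.elim _ _⟩
    rw [this, Nat.sub_self, Nat.factorial_zero, Nat.card_eq_fintype_card, Fintype.card_eq_one_iff]
    exact ⟨⟨1, fun a b => Subsingleton.elim a b ▸ Equiv.Perm.SameCycle.refl _ _⟩,
      fun σ => Subtype.ext (Subsingleton.elim _ _)⟩
  · have h2 : 2 ≤ Fintype.card A := Fintype.one_lt_card
    have := Equiv.Perm.card_of_cycleType_singleton (α := A) h2 le_rfl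
    rw [Nat.choose_self, mul_one] at this
    rw [← this, Nat.card_eq_fintype_card, Fintype.card_subtype]
    congr 1
    ext σ
    simp only [Finset.mem_filter, Finset.mem_univ, true_and]
    constructor
    · intro h
      have hne : ∀ a, σ a ≠ a := fun a ha => by
        obtain ⟨b, hb⟩ := exists_ne a
        exact hb (((h a b).eq_of_left ha).symm)
      have hc : σ.IsCycle :=
        ⟨Classical.arbitrary A, hne _, fun b _ => h _ b⟩
      rw [hc.cycleType]
      have : σ.support = Finset.univ := by
        ext a
        simpa using hne a
      rw [this, Finset.card_univ]
    · intro h a b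
      have hc : σ.IsCycle := Equiv.Perm.card_cycleType_eq_one.1 (by rw [h]; rfl)
      rw [hc.cycleType, Multiset.singleton_inj] at h
      have hs : σ.support = Finset.univ := Finset.eq_univ_of_card _ h
      have hne : ∀ a, σ a ≠ a := fun a => by
        have : a ∈ σ.support := hs ▸ Finset.mem_univ a
        simpa using this
      exact hc.sameCycle (hne a) (hne b)

/-- Permutations whose orbits are the fibres of a map are families of transitive permutations of
the fibres. -/
noncomputable def Equiv.Perm.orbitFibreEquiv {A ι : Type*} (f : A → ι) :
    {σ : Equiv.Perm A // ∀ a b, σ.SameCycle a b ↔ f a = f b} ≃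
      ((i : ι) → {τ : Equiv.Perm {a // f a = i} // ∀ a b, τ.SameCycle a b}) where
  toFun σ i :=
    have h : ∀ a, f (σ.1 a) = f a := fun a =>
      (σ.2 _ _).1 (Equiv.Perm.sameCycle_apply_left.2 (Equiv.Perm.SameCycle.refl _ _))
    ⟨σ.1.subtypePerm fun a => by rw [h a], fun a b => by
      rw [Equiv.Perm.sameCycle_subtypePerm, σ.2, a.2, b.2]⟩
  invFun τ :=
    let σ : Equiv.Perm A :=
      { toFun := fun a => ((τ (f a)).1 ⟨a, rfl⟩).1
        invFun := fun a => ((τ (f a)).1.symm ⟨a, rfl⟩).1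
        left_inv := fun a => by
          have key : ∀ (i : ι) (x : {a // f a = i}),
              ((τ (f x.1)).1.symm ⟨x.1, rfl⟩).1 = ((τ i).1.symm x).1 := by
            rintro i ⟨x, rfl⟩
            rfl
          have := key (f a) ((τ (f a)).1 ⟨a, rfl⟩)
          exact this.trans (congrArg Subtype.val (Equiv.symm_apply_apply _ _))
        right_inv := fun a => by
          have key : ∀ (i : ι) (x : {a // f a = i}),
              ((τ (f x.1)).1 ⟨x.1, rfl⟩).1 = ((τ i).1 x).1 := by
            rintro i ⟨x, rfl⟩
            rfl
          have := key (f a) ((τ (f a)).1.symm ⟨a, rfl⟩)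
          exact this.trans (congrArg Subtype.val (Equiv.apply_symm_apply _ _)) }
    have hσ : ∀ a, f (σ a) = f a := fun a => ((τ (f a)).1 ⟨a, rfl⟩).2
    have hsub : ∀ i, σ.subtypePerm (p := fun a => f a = i) (fun a => by rw [hσ]) = (τ i).1 :=
      fun i => by
        ext ⟨a, rfl⟩
        rfl
    ⟨σ, fun a b => by
      constructor
      · rintro ⟨k, rfl⟩
        have : ∀ k : ℤ, f ((σ ^ k) a) = f a := fun k => by
          induction k with
          | zero => simp
          | succ k ih => rw [add_comm, zpow_add, zpow_one, Equiv.Perm.mul_apply, hσ, ih]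
          | pred k ih =>
            rw [← ih, ← hσ ((σ ^ (-(k : ℤ) - 1)) a), ← Equiv.Perm.mul_apply, ← zpow_one_add]
            congr 3
            ring
        exact (this k).symm
      · intro hab
        have h := (τ (f b)).2 ⟨a, hab⟩ ⟨b, rfl⟩
        rw [← hsub, Equiv.Perm.sameCycle_subtypePerm] at h
        exact h⟩
  left_inv σ := by
    ext a
    rfl
  right_inv τ := by
    funext i
    ext ⟨a, rfl⟩
    rfl

/-- The partition of a finite type into the orbits of a permutation. -/
noncomputable def Equiv.Perm.orbitPartition {A : Type*} [Fintype A] (σ : Equiv.Perm A) :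
    Finpartition (Finset.univ : Finset A) :=
  Finpartition.ofSetoid (Equiv.Perm.SameCycle.setoid σ)

theorem Equiv.Perm.mem_part_orbitPartition {A : Type*} [Fintype A] (σ : Equiv.Perm A) (a b : A) :
    b ∈ σ.orbitPartition.part a ↔ σ.SameCycle a b :=
  Finpartition.mem_part_ofSetoid_iff_rel

theorem Finpartition.ext_part {A : Type*} [Fintype A]
    {P Q : Finpartition (Finset.univ : Finset A)} (h : ∀ a b, b ∈ P.part a ↔ b ∈ Q.part a) :
    P = Q := by
  have hpart : ∀ a, P.part a = Q.part a := fun a => Finset.ext (h a)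
  have key : ∀ (P Q : Finpartition (Finset.univ : Finset A)),
      (∀ a, P.part a = Q.part a) → P.parts ⊆ Q.parts := by
    intro P Q h B hB
    obtain ⟨a, ha⟩ := P.nonempty_of_mem_parts hB
    rw [← P.part_eq_of_mem hB ha, h]
    exact Q.part_mem.2 (Finset.mem_univ _)
  exact Finpartition.ext (Finset.Subset.antisymm (key P Q hpart) (key Q P fun a => (hpart a).symm))

theorem Equiv.Perm.orbitPartition_eq_iff {A : Type*} [Fintype A] (σ : Equiv.Perm A)
    (P : Finpartition (Finset.univ : Finset A)) :
    σ.orbitPartition = P ↔ ∀ a b, σ.SameCycle a b ↔ P.part a = P.part b := by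
  have hP : ∀ a b, b ∈ P.part a ↔ P.part a = P.part b := fun a b => by
    rw [P.mem_part_iff_part_eq_part (Finset.mem_univ _) (Finset.mem_univ _), eq_comm]
  constructor
  · rintro rfl a b
    rw [← hP, σ.mem_part_orbitPartition]
  · intro h
    refine Finpartition.ext_part fun a b => ?_
    rw [σ.mem_part_orbitPartition, h, hP]

theorem Equiv.Perm.card_orbitPartition_eq {A : Type*} [Fintype A]
    (P : Finpartition (Finset.univ : Finset A)) :
    (Finset.univ.filter fun σ : Equiv.Perm A => σ.orbitPartition = P).card =
      ∏ B ∈ P.parts, (B.card - 1).factorial := by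
  let f : A → P.parts := fun a => ⟨P.part a, P.part_mem.2 (Finset.mem_univ a)⟩
  have hf : ∀ a b, f a = f b ↔ P.part a = P.part b := fun a b => Subtype.ext_iff
  rw [← Fintype.card_subtype, Fintype.card_congr ((Equiv.subtypeEquivRight fun σ => by
      simp only [σ.orbitPartition_eq_iff, ← hf]).trans (Equiv.Perm.orbitFibreEquiv f)),
    Fintype.card_pi, ← Finset.prod_coe_sort P.parts fun B => (B.card - 1).factorial]
  refine Finset.prod_congr rfl fun B _ => ?_
  have hmem : ∀ a, f a = B ↔ a ∈ B.1 := fun a => by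
    rw [Subtype.ext_iff]
    exact P.part_eq_iff_mem B.2
  have : Nonempty {a // f a = B} := by
    obtain ⟨a, ha⟩ := P.nonempty_of_mem_parts B.2
    exact ⟨⟨a, (hmem a).2 ha⟩⟩
  rw [← Nat.card_eq_fintype_card, Equiv.Perm.card_transitive]
  congr 2
  rw [Fintype.card_congr (Equiv.subtypeEquivRight hmem), Fintype.card_coe]

theorem Equiv.Perm.comp_eq_iff_orbit {A ι : Type*} [Fintype A] (f : A → ι)
    (σ : Equiv.Perm A) :
    f ∘ σ = f ↔ ∀ a, ∀ b ∈ σ.orbitPartition.part a, f a = f b := by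
  simp only [σ.mem_part_orbitPartition]
  constructor
  · rintro h a b hab
    obtain ⟨n, rfl⟩ := hab.exists_nat_pow_eq
    clear hab
    induction n with
    | zero => rfl
    | succ n ih => rw [pow_succ', Equiv.Perm.mul_apply, ih]; exact (congrFun h _).symm
  · intro h
    funext a
    exact (h a (σ a) (Equiv.Perm.sameCycle_apply_right.2 (Equiv.Perm.SameCycle.refl _ _))).symm

theorem Equiv.Perm.card_comp_eq {A ι : Type*} [Fintype A] (f : A → ι) :
    Nat.card {σ : Equiv.Perm A // f ∘ σ = f} =
      ∑ P : Finpartition (Finset.univ : Finset A) with ∀ a, ∀ b ∈ P.part a, f a = f b,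
        ∏ B ∈ P.parts, (B.card - 1).factorial := by
  rw [Nat.card_eq_fintype_card, Fintype.card_subtype, Finset.card_eq_sum_card_fiberwise
    (f := fun σ : Equiv.Perm A => σ.orbitPartition)
    (t := Finset.univ.filter fun P : Finpartition (Finset.univ : Finset A) =>
      ∀ a, ∀ b ∈ P.part a, f a = f b)]
  · refine Finset.sum_congr rfl fun P hP => ?_
    rw [← Equiv.Perm.card_orbitPartition_eq, Finset.filter_filter]
    congr 1
    refine Finset.filter_congr fun σ _ => ?_
    rw [and_iff_right_iff_imp]
    rintro rfl
    exact (Equiv.Perm.comp_eq_iff_orbit f σ).2 (Finset.mem_filter.1 hP).2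
  · intro σ hσ
    simpa using (Equiv.Perm.comp_eq_iff_orbit f σ).1 (Finset.mem_filter.1 hσ).2

/-! ### Linear orderings with prescribed first elements -/

namespace TreeShuffle

theorem LinOrd.ext {A : Type*} {r s : LinOrd A} (h : ∀ a b, r.1 a b ↔ s.1 a b) : r = s :=
  Subtype.ext (funext fun a => funext fun b => propext (h a b))

/-- Numbering the elements of `A` identifies `A ≃ Fin n` with the linear orderings of `A`. -/
theorem LinOrd.bijective_ofEquiv (A : Type*) [Fintype A] :
    Function.Bijective fun e : A ≃ Fin (Fintype.card A) =>
      (⟨fun a b => e a < e b,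
        { trichotomous := fun _ _ h1 h2 => e.injective (le_antisymm (not_lt.1 h2) (not_lt.1 h1))
          irrefl := fun _ => lt_irrefl _
          trans := fun _ _ _ => lt_trans }⟩ : LinOrd A) := by
  constructor
  · intro e e' h
    have h' : ∀ a b, e a < e b ↔ e' a < e' b := fun a b =>
      iff_of_eq (congrFun (congrFun (congrArg Subtype.val h) a) b)
    let g : Fin (Fintype.card A) ≃o Fin (Fintype.card A) :=
      { toEquiv := e.symm.trans e'
        map_rel_iff' := fun {i j} => by
          rw [← not_lt, ← not_lt, not_iff_not]
          simpa using (h' (e.symm j) (e.symm i)).symm }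
    have hg : g = OrderIso.refl _ := Subsingleton.elim _ _
    ext a
    have h2 : e' a = e a := by simpa [g] using DFunLike.congr_fun hg (e a)
    rw [h2]
  · intro r
    have := r.2
    let _ : LinearOrder A := linearOrderOfSTO r.1
    refine ⟨(monoEquivOfFin A rfl).symm.toEquiv, LinOrd.ext fun a b => ?_⟩
    exact (monoEquivOfFin A rfl).symm.lt_iff_lt

/-- The linear orderings along which `f` is weakly increasing are as numerous as the permutations
preserving `f`: all of them list the values of `f` in the same way. -/
theorem LinOrd.card_monotone {A : Type*} [Fintype A] (f : A → ℕ) :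
    Nat.card {r : LinOrd A // ∀ a b, f a < f b → r.1 a b} =
      Nat.card {σ : Equiv.Perm A // f ∘ σ = f} := by
  let e₁ := Fintype.equivFin A
  let e₀ : A ≃ Fin (Fintype.card A) := e₁.trans (Tuple.sort (f ∘ e₁.symm)).symm
  have he₀ : Monotone (f ∘ e₀.symm) := Tuple.monotone_sort (f ∘ e₁.symm)
  have hmono : ∀ e : A ≃ Fin (Fintype.card A),
      (∀ a b, f a < f b → e a < e b) ↔ f ∘ e.symm = f ∘ e₀.symm := by
    intro e
    have h1 : (∀ a b, f a < f b → e a < e b) ↔ Monotone (f ∘ e.symm) := by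
      constructor
      · intro h i j hij
        by_contra hlt
        have := h _ _ (not_le.1 hlt)
        simp only [Equiv.apply_symm_apply] at this
        exact absurd hij (not_le.2 this)
      · intro h a b hab
        by_contra hlt
        have := h (not_lt.1 hlt)
        simp only [Function.comp_apply, Equiv.symm_apply_apply] at this
        omega
    rw [h1]
    constructor
    · intro h
      have := Tuple.unique_monotone (f := f ∘ e₀.symm) (σ := e.symm.trans e₀) (τ := 1)
        (by simpa [Function.comp_def] using h) (by simpa using he₀)
      simpa [Function.comp_def] using this
    · intro h
      rw [h]
      exact he₀
  let F : (A ≃ Fin (Fintype.card A)) ≃ Equiv.Perm A :=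
    { toFun := fun e => e.trans e₀.symm
      invFun := fun σ => σ.trans e₀
      left_inv := fun e => by ext; simp
      right_inv := fun σ => by ext; simp }
  have hF : ∀ e : A ≃ Fin (Fintype.card A),
      f ∘ e.symm = f ∘ e₀.symm ↔ f ∘ F e = f := fun e => by
    rw [Equiv.comp_symm_eq, eq_comm]
    rfl
  exact (Nat.card_congr (Equiv.subtypeEquiv
    (Equiv.ofBijective _ (LinOrd.bijective_ofEquiv A)) fun e => (hmono e).symm)).symm.trans
      (Nat.card_congr (Equiv.subtypeEquiv F hF))

/-- Successively moving the elements satisfying each of the predicates to the front, starting with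
the head of the list. -/
def LinOrd.act {A : Type*} (l : List (A → Prop)) (r : LinOrd A) : LinOrd A :=
  l.foldl (fun r R => r.toFront R) r

/-- A list of moves orders the elements by a numerical code that tells which predicates they
satisfy (the last predicate being the most significant one), and keeps the given order among
elements with the same code. -/
theorem LinOrd.exists_code {A : Type*} (l : List (A → Prop)) :
    ∃ f : A → ℕ, (∀ a b, f a = f b ↔ ∀ R ∈ l, R a ↔ R b) ∧
      ∀ (r : LinOrd A) a b, (LinOrd.act l r).1 a b ↔ f a < f b ∨ (f a = f b ∧ r.1 a b) := by
  induction l with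
  | nil => exact ⟨fun _ => 0, by simp, by simp [LinOrd.act]⟩
  | cons R l ih =>
    obtain ⟨f, hf, hr⟩ := ih
    refine ⟨fun a => 2 * f a + if R a then 0 else 1, fun a b => ?_, fun r a b => ?_⟩
    · rw [List.forall_mem_cons, ← hf]
      by_cases ha : R a <;> by_cases hb : R b <;> simp [ha, hb] <;> omega
    · have : LinOrd.act (R :: l) r = LinOrd.act l (r.toFront R) := rfl
      rw [this, hr]
      have h2 : (r.toFront R).1 a b ↔ (R a ∧ ¬ R b) ∨ ((R a ↔ R b) ∧ r.1 a b) := Iff.rfl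
      rw [h2]
      by_cases ha : R a <;> by_cases hb : R b <;> simp [ha, hb] <;> omega

/-- The linear orderings fixed by a list of moves are those along which its code increases. -/
theorem LinOrd.act_eq_self_iff {A : Type*} {l : List (A → Prop)} {f : A → ℕ} {r : LinOrd A}
    (hr : ∀ a b, (LinOrd.act l r).1 a b ↔ f a < f b ∨ (f a = f b ∧ r.1 a b)) :
    LinOrd.act l r = r ↔ ∀ a b, f a < f b → r.1 a b := by
  have := r.2
  have hirr : ∀ a, ¬ r.1 a a := fun a => Std.Irrefl.irrefl a
  have htr : ∀ a b c, r.1 a b → r.1 b c → r.1 a c := fun a b c => IsTrans.trans a b c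
  constructor
  · intro h a b hab
    rw [← h, hr]
    exact Or.inl hab
  · refine fun h => LinOrd.ext fun a b => ?_
    rw [hr]
    constructor
    · rintro (hab | hab)
      · exact h a b hab
      · exact hab.2
    · intro hab
      rcases lt_trichotomy (f a) (f b) with hlt | heq | hgt
      · exact Or.inl hlt
      · exact Or.inr ⟨heq, hab⟩
      · exact absurd (htr _ _ _ hab (h b a hgt)) (hirr a)

/-- The number of linear orderings fixed by a list of moves, as a sum over the partitions whose
blocks are not split by any of the predicates. -/
theorem LinOrd.card_fixed {A : Type*} [Fintype A] (l : List (A → Prop)) :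
    Nat.card {r : LinOrd A // LinOrd.act l r = r} =
      ∑ P : Finpartition (Finset.univ : Finset A) with
        ∀ R ∈ l, ∀ a, ∀ b ∈ P.part a, (R a ↔ R b),
        ∏ B ∈ P.parts, (B.card - 1).factorial := by
  obtain ⟨f, hf, hr⟩ := LinOrd.exists_code l
  have hcard : Nat.card {r : LinOrd A // LinOrd.act l r = r} =
      Nat.card {r : LinOrd A // ∀ a b, f a < f b → r.1 a b} :=
    Nat.card_congr (Equiv.subtypeEquivRight fun r => LinOrd.act_eq_self_iff (hr r))
  rw [hcard, LinOrd.card_monotone, Equiv.Perm.card_comp_eq]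
  refine Finset.sum_congr ?_ fun _ _ => rfl
  ext P
  simp only [Finset.mem_filter, Finset.mem_univ, true_and, hf]
  exact ⟨fun h R hR a b hb => h a b hb R hR, fun h a b hb R hR => h R hR a b hb⟩

end TreeShuffle

/-! ### Compositions of moves on local orderings -/

namespace TreeShuffle

/-- Successive moves by the sets of leaves in a list, starting with the head of the list. -/
def moves {T : RootedTree} (l : List (Finset (Leaf T))) (π : LocalOrdering T) : LocalOrdering T :=
  l.foldl (fun π E => move E π) π

theorem moves_apply {T : RootedTree} (l : List (Finset (Leaf T))) (π : LocalOrdering T)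
    (x : Inner T) :
    moves l π x = LinOrd.act (l.map fun E (y : Children x.1) => Related E y.1) (π x) := by
  induction l generalizing π with
  | nil => rfl
  | cons E l ih => exact ih (move E π)

/-- The list `l` determines `E` if siblings that are not separated by any member of `l`, by being
related to it or not, are not separated by `E` either. -/
def Determines {T : RootedTree} (l : List (Finset (Leaf T))) (E : Finset (Leaf T)) : Prop :=
  ∀ (x : Inner T) (a b : Children x.1),
    (∀ F ∈ l, Related F a.1 ↔ Related F b.1) → (Related E a.1 ↔ Related E b.1)

/-- A move that is determined by the subsequent moves has no effect. -/
theorem moves_cons_of_determines {T : RootedTree} {l : List (Finset (Leaf T))}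
    {E : Finset (Leaf T)} (h : Determines l E) (π : LocalOrdering T) :
    moves (E :: l) π = moves l π := by
  funext x
  have h1 : moves (E :: l) π x = moves l (move E π) x := rfl
  rw [h1, moves_apply, moves_apply]
  obtain ⟨f, hf, hr⟩ := LinOrd.exists_code (l.map fun E (y : Children x.1) => Related E y.1)
  refine LinOrd.ext fun a b => ?_
  rw [hr, hr]
  refine or_congr Iff.rfl (and_congr_right fun hab => ?_)
  have hE : Related E a.1 ↔ Related E b.1 := h x a b fun F hF =>
    (hf a b).1 hab _ (List.mem_map_of_mem hF)
  have h2 : (move E π x).1 a b ↔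
      (Related E a.1 ∧ ¬ Related E b.1) ∨ ((Related E a.1 ↔ Related E b.1) ∧ (π x).1 a b) :=
    Iff.rfl
  rw [h2]
  tauto

theorem compatible_iff {T : RootedTree} [Finite T] (α : TreePart T) (E : Finset (Leaf T)) :
    Compatible α E ↔ ∀ x, ∀ a, ∀ b ∈ (α x).part a, (Related E a.1 ↔ Related E b.1) := by
  refine forall_congr' fun x => ?_
  constructor
  · intro h a b hb
    obtain ⟨C, hC, hsub⟩ := h ((α x).part_mem.2 (Finset.mem_univ a))
    have haC : a ∈ C := hsub ((α x).mem_part_self.2 (Finset.mem_univ a))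
    have hbC : b ∈ C := hsub hb
    have hC' := Finset.mem_of_mem_erase hC
    simp only [Finset.mem_insert, Finset.mem_singleton] at hC'
    rcases hC' with rfl | rfl
    · simp only [Finset.mem_filter, Finset.mem_univ, true_and] at haC hbC
      exact iff_of_true haC hbC
    · simp only [Finset.mem_filter, Finset.mem_univ, true_and] at haC hbC
      exact iff_of_false haC hbC
  · intro h B hB
    obtain ⟨a, ha⟩ := (α x).nonempty_of_mem_parts hB
    have hBa : ∀ b ∈ B, (Related E a.1 ↔ Related E b.1) := fun b hb =>
      h a b ((α x).part_eq_of_mem hB ha ▸ hb)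
    by_cases hE : Related E a.1
    · refine ⟨Finset.univ.filter fun y => Related E y.1,
        Finset.mem_erase.2 ⟨?_, by simp⟩, fun b hb => ?_⟩
      · exact Finset.ne_empty_of_mem (Finset.mem_filter.2 ⟨Finset.mem_univ a, hE⟩)
      · exact Finset.mem_filter.2 ⟨Finset.mem_univ b, (hBa b hb).1 hE⟩
    · refine ⟨Finset.univ.filter fun y => ¬ Related E y.1,
        Finset.mem_erase.2 ⟨?_, by simp⟩, fun b hb => ?_⟩
      · exact Finset.ne_empty_of_mem (Finset.mem_filter.2 ⟨Finset.mem_univ a, hE⟩)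
      · exact Finset.mem_filter.2 ⟨Finset.mem_univ b, fun hb' => hE ((hBa b hb).2 hb')⟩

/-- The sets determined by a list are those compatible with the common refinement of the partitions
induced by its members. -/
theorem exists_compatible_iff_determines {T : RootedTree} [Finite T]
    (l : List (Finset (Leaf T))) :
    ∃ α : TreePart T, ∀ E, Compatible α E ↔ Determines l E := by
  let s : (x : Inner T) → Setoid (Children x.1) := fun x =>
    { r := fun a b => ∀ F ∈ l, Related F a.1 ↔ Related F b.1
      iseqv :=
        { refl := fun _ _ _ => Iff.rfl
          symm := fun h F hF => (h F hF).symm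
          trans := fun h h' F hF => (h F hF).trans (h' F hF) } }
  refine ⟨fun x => Finpartition.ofSetoid (s x), fun E => ?_⟩
  simp only [compatible_iff, Finpartition.mem_part_ofSetoid_iff_rel]
  exact Iff.rfl

/-- The number of local orderings fixed by a composition of moves. -/
theorem card_fixed_moves {T : RootedTree} [Finite T] (l : List (Finset (Leaf T))) :
    Nat.card {π : LocalOrdering T // moves l π = π} =
      ∑ α : TreePart T with ∀ E ∈ l, Compatible α E, mult α := by
  have h1 : ∀ π : LocalOrdering T, moves l π = π ↔ ∀ x,
      LinOrd.act (l.map fun E (y : Children x.1) => Related E y.1) (π x) = π x := fun π =>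
    ⟨fun h x => by rw [← moves_apply, h], fun h => funext fun x => by rw [moves_apply, h]⟩
  let e : {π : LocalOrdering T // moves l π = π} ≃ ((x : Inner T) → {r : LinOrd (Children x.1) //
      LinOrd.act (l.map fun E (y : Children x.1) => Related E y.1) r = r}) :=
    { toFun := fun π x => ⟨π.1 x, (h1 π.1).1 π.2 x⟩
      invFun := fun g => ⟨fun x => (g x).1, (h1 _).2 fun x => (g x).2⟩
      left_inv := fun _ => rfl
      right_inv := fun _ => rfl }
  rw [Nat.card_congr e, Nat.card_pi]
  simp only [LinOrd.card_fixed]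
  rw [Finset.prod_univ_sum]
  refine Finset.sum_congr ?_ fun _ _ => rfl
  ext α
  simp only [Fintype.mem_piFinset, Finset.mem_filter, Finset.mem_univ, true_and, compatible_iff,
    List.forall_mem_map]
  exact ⟨fun h E hE x => h x E hE, fun h x E hE => h E hE x⟩

theorem mult_pos {T : RootedTree} [Finite T] (α : TreePart T) : 0 < mult α :=
  Finset.prod_pos fun _ _ => Finset.prod_pos fun _ _ => Nat.factorial_pos _

/-! ### The transition matrix -/

/-- The transition matrix of a composition of moves. -/
noncomputable def movesMatrix {T : RootedTree} [Finite T] (l : List (Finset (Leaf T))) :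
    Matrix (LocalOrdering T) (LocalOrdering T) ℝ :=
  Matrix.of fun π π' => if moves l π = π' then 1 else 0

theorem movesMatrix_nil {T : RootedTree} [Finite T] :
    movesMatrix ([] : List (Finset (Leaf T))) = 1 := by
  ext π π'
  rw [Matrix.one_apply]
  rfl

theorem trace_movesMatrix {T : RootedTree} [Finite T] (l : List (Finset (Leaf T))) :
    (movesMatrix l).trace = ∑ α : TreePart T with ∀ E ∈ l, Compatible α E, (mult α : ℝ) := by
  rw [← Nat.cast_sum, ← card_fixed_moves, Nat.card_eq_fintype_card, Fintype.card_subtype]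
  simp [Matrix.trace, movesMatrix]

theorem transition_mul_movesMatrix {T : RootedTree} [Finite T] (w : Finset (Leaf T) → ℝ)
    (l : List (Finset (Leaf T))) :
    transition w * movesMatrix l = ∑ E, w E • movesMatrix (E :: l) := by
  ext π π'
  simp only [Matrix.mul_apply, transition, movesMatrix, Matrix.of_apply, Matrix.sum_apply,
    Matrix.smul_apply, smul_eq_mul, Finset.sum_filter, Finset.sum_mul]
  rw [Finset.sum_comm]
  refine Finset.sum_congr rfl fun E _ => ?_
  simp only [ite_mul, zero_mul]
  rw [Finset.sum_ite_eq, if_pos (Finset.mem_univ _)]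
  rfl

theorem trace_transition_pow_mul {T : RootedTree} [Finite T] (w : Finset (Leaf T) → ℝ) (k : ℕ)
    (l : List (Finset (Leaf T))) :
    (transition w ^ k * movesMatrix l).trace =
      ∑ α : TreePart T with ∀ E ∈ l, Compatible α E, (mult α : ℝ) * eigval w α ^ k := by
  induction k generalizing l with
  | zero => simp [trace_movesMatrix]
  | succ k ih =>
    rw [pow_succ, mul_assoc, transition_mul_movesMatrix, Finset.mul_sum, Matrix.trace_sum]
    simp only [mul_smul_comm, Matrix.trace_smul, ih, List.forall_mem_cons, smul_eq_mul,
      Finset.mul_sum, Finset.sum_filter]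
    rw [Finset.sum_comm]
    refine Finset.sum_congr rfl fun α _ => ?_
    by_cases hα : ∀ E ∈ l, Compatible α E
    · simp only [and_iff_left hα]
      rw [if_pos hα, pow_succ, ← mul_assoc]
      nth_rw 3 [eigval]
      rw [Finset.sum_filter, Finset.mul_sum]
      refine Finset.sum_congr rfl fun E _ => ?_
      split_ifs <;> ring
    · simp [hα]

theorem trace_transition_pow {T : RootedTree} [Finite T] (w : Finset (Leaf T) → ℝ) (k : ℕ) :
    (transition w ^ k).trace = ∑ α : TreePart T, (mult α : ℝ) * eigval w α ^ k := by
  have := trace_transition_pow_mul w k []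
  simpa [movesMatrix_nil] using this

/-- The total weight of the sets determined by a list. -/
noncomputable def determinedWeight {T : RootedTree} [Finite T] (w : Finset (Leaf T) → ℝ)
    (l : List (Finset (Leaf T))) : ℝ :=
  ∑ E with Determines l E, w E

theorem determinedWeight_mem_range {T : RootedTree} [Finite T] (w : Finset (Leaf T) → ℝ)
    (l : List (Finset (Leaf T))) :
    determinedWeight w l ∈ Finset.univ.image (eigval w) := by
  obtain ⟨α, hα⟩ := exists_compatible_iff_determines l
  refine Finset.mem_image.2 ⟨α, Finset.mem_univ _, ?_⟩
  simp only [eigval, determinedWeight, hα]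

theorem determinedWeight_lt_cons {T : RootedTree} [Finite T] {w : Finset (Leaf T) → ℝ}
    (hw : ∀ E, 0 ≤ w E) {l : List (Finset (Leaf T))} {E : Finset (Leaf T)}
    (hE : ¬ Determines l E) (hwE : w E ≠ 0) :
    determinedWeight w l < determinedWeight w (E :: l) := by
  refine Finset.sum_lt_sum_of_subset (i := E) ?_ ?_ ?_ ((hw E).lt_of_ne' hwE) fun F _ _ => hw F
  · intro F hF
    rw [Finset.mem_filter] at hF ⊢
    exact ⟨hF.1, fun x a b h => hF.2 x a b fun G hG => h G (List.mem_cons_of_mem _ hG)⟩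
  · exact Finset.mem_filter.2 ⟨Finset.mem_univ _, fun x a b h => h E List.mem_cons_self⟩
  · exact fun h => hE (Finset.mem_filter.1 h).2

theorem transition_sub_mul_movesMatrix {T : RootedTree} [Finite T] (w : Finset (Leaf T) → ℝ)
    (l : List (Finset (Leaf T))) :
    (transition w - algebraMap ℝ _ (determinedWeight w l)) * movesMatrix l =
      ∑ E with ¬ Determines l E, w E • movesMatrix (E :: l) := by
  rw [sub_mul, transition_mul_movesMatrix, Algebra.algebraMap_eq_smul_one, smul_mul_assoc, one_mul,
    sub_eq_iff_eq_add, add_comm, ← Finset.sum_filter_add_sum_filter_not _ (Determines l),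
    determinedWeight, Finset.sum_smul]
  congr 1
  refine Finset.sum_congr rfl fun E hE => ?_
  congr 1
  ext π π'
  simp only [movesMatrix, Matrix.of_apply, moves_cons_of_determines (Finset.mem_filter.1 hE).2]

open Polynomial in
/-- Only the factors for values at least `determinedWeight w l` are needed to annihilate
`movesMatrix l`: each of them leads to matrices of longer lists with strictly larger weight. -/
theorem aeval_transition_mul_movesMatrix {T : RootedTree} [Finite T] {w : Finset (Leaf T) → ℝ}
    (hw : ∀ E, 0 ≤ w E) {S : Finset ℝ} (hS : ∀ l, determinedWeight w l ∈ S)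
    (l : List (Finset (Leaf T))) :
    aeval (transition w) (∏ c ∈ S with determinedWeight w l ≤ c, (X - C c)) * movesMatrix l =
      0 := by
  induction hn : (S.filter fun c => determinedWeight w l ≤ c).card using Nat.strong_induction_on
    generalizing l with
  | _ n ih =>
    have hins : S.filter (fun c => determinedWeight w l ≤ c) =
        insert (determinedWeight w l) (S.filter fun c => determinedWeight w l < c) := by
      ext c
      simp only [Finset.mem_filter, Finset.mem_insert, le_iff_eq_or_lt]
      constructor
      · rintro ⟨hc, rfl | h⟩
        · exact Or.inl rfl
        · exact Or.inr ⟨hc, h⟩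
      · rintro (rfl | ⟨hc, h⟩)
        · exact ⟨hS l, Or.inl rfl⟩
        · exact ⟨hc, Or.inr h⟩
    rw [hins, Finset.prod_insert (by simp), mul_comm, map_mul, mul_assoc, map_sub, aeval_X, aeval_C,
      transition_sub_mul_movesMatrix, Finset.mul_sum]
    refine Finset.sum_eq_zero fun E hE => ?_
    rw [mul_smul_comm]
    by_cases hwE : w E = 0
    · rw [hwE, zero_smul]
    have hlt := determinedWeight_lt_cons hw (Finset.mem_filter.1 hE).2 hwE
    have hsub : S.filter (fun c => determinedWeight w (E :: l) ≤ c) ⊆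
        S.filter fun c => determinedWeight w l < c :=
      Finset.monotone_filter_right _ fun c _ hc => hlt.trans_le hc
    -- the remaining factors include all those that annihilate the matrix of `E :: l`
    obtain ⟨q, hq⟩ := Finset.prod_dvd_prod_of_subset _ _ (fun c : ℝ => X - C c) hsub
    rw [hq, mul_comm, map_mul, mul_assoc, ih _ ?_ (E :: l) rfl, mul_zero, smul_zero]
    rw [← hn, hins, Finset.card_insert_of_notMem (by simp)]
    exact Nat.lt_succ_of_le (Finset.card_le_card hsub)

open Polynomial in
theorem aeval_transition_eq_zero {T : RootedTree} [Finite T] {w : Finset (Leaf T) → ℝ}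
    (hw : ∀ E, 0 ≤ w E) :
    aeval (transition w) (∏ c ∈ Finset.univ.image (eigval w), (X - C c)) = 0 := by
  have h := aeval_transition_mul_movesMatrix hw (determinedWeight_mem_range w) []
  rw [movesMatrix_nil, mul_one] at h
  obtain ⟨q, hq⟩ := Finset.prod_dvd_prod_of_subset _ _ (fun c : ℝ => X - C c)
    (Finset.filter_subset (fun c => determinedWeight w [] ≤ c) (Finset.univ.image (eigval w)))
  rw [hq, map_mul, h, zero_mul]

end TreeShuffle

theorem theorem2p1 (T : RootedTree) [Finite T] (hT : TreeShuffle.IsPure T)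
    (w : Finset (TreeShuffle.Leaf T) → ℝ) (hw_nonneg : ∀ E, 0 ≤ w E) (hw_sum : ∑ E, w E = 1) :
    -- (i)
    (TreeShuffle.transition w).Diagonalizable ∧
    -- (ii)
    (∀ α : TreeShuffle.TreePart T,
      Module.End.HasEigenvalue (Matrix.toLin' (TreeShuffle.transition w))
        (TreeShuffle.eigval w α)) ∧
    -- (iii): multiplicities, those of coinciding values being added, both in the
    -- characteristic polynomial and as dimensions of eigenspaces
    ((TreeShuffle.transition w).charpoly =
      ∏ α : TreeShuffle.TreePart T,
        (Polynomial.X - Polynomial.C (TreeShuffle.eigval w α)) ^ TreeShuffle.mult α) ∧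
    (∀ c : ℝ,
      Module.finrank ℝ
          (Module.End.eigenspace (Matrix.toLin' (TreeShuffle.transition w)) c) =
        ∑ α : TreeShuffle.TreePart T with TreeShuffle.eigval w α = c, TreeShuffle.mult α) ∧
    -- (iv): there are no other eigenvalues, not even complex ones
    (∀ z : ℂ,
      Module.End.HasEigenvalue
          (Matrix.toLin' ((TreeShuffle.transition w).map (fun t : ℝ => (t : ℂ)))) z →
        ∃ α : TreeShuffle.TreePart T, z = (TreeShuffle.eigval w α : ℂ)) := by
  obtain ⟨S, d, hSd⟩ := Matrix.diagonalizable_of_aeval_eq_zero _ _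
    (TreeShuffle.aeval_transition_eq_zero hw_nonneg)
  have hcard : ∀ c : ℝ, (Finset.univ.filter fun π => d π = c).card =
      ∑ α : TreeShuffle.TreePart T with TreeShuffle.eigval w α = c, TreeShuffle.mult α :=
    card_filter_eq_sum_of_power_sums d (TreeShuffle.eigval w) TreeShuffle.mult fun k => by
      rw [← TreeShuffle.trace_transition_pow, hSd, Matrix.trace_pow_conj_diagonal]
  have hfin : ∀ c : ℝ, Module.finrank ℝ
      (Module.End.eigenspace (Matrix.toLin' (TreeShuffle.transition w)) c) =
        ∑ α : TreeShuffle.TreePart T with TreeShuffle.eigval w α = c, TreeShuffle.mult α := by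
    intro c
    rw [← hcard, hSd, Matrix.finrank_eigenspace_conj_diagonal]
  have hchar : (TreeShuffle.transition w).charpoly = ∏ α : TreeShuffle.TreePart T,
      (Polynomial.X - Polynomial.C (TreeShuffle.eigval w α)) ^ TreeShuffle.mult α := by
    rw [hSd, Matrix.charpoly_conj_diagonal]
    refine Finset.prod_eq_prod_pow_of_card_filter d (TreeShuffle.eigval w) TreeShuffle.mult
      (fun c => ?_) fun c => Polynomial.X - Polynomial.C c
    convert hcard c
  refine ⟨⟨S, d, hSd⟩, fun α => ?_, hchar, hfin, fun z hz => ?_⟩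
  · rw [Module.End.hasEigenvalue_iff]
    intro hbot
    have h := hfin (TreeShuffle.eigval w α)
    rw [hbot, finrank_bot, eq_comm, Finset.sum_eq_zero_iff] at h
    exact (TreeShuffle.mult_pos α).ne' (h α (by simp))
  · have hroot := (Module.End.hasEigenvalue_iff_isRoot_charpoly _ _).1 hz
    rw [Matrix.charpoly_toLin'] at hroot
    have hmap := Matrix.charpoly_map (TreeShuffle.transition w) Complex.ofRealHom
    have hroot' : Polynomial.IsRoot
        ((TreeShuffle.transition w).charpoly.map Complex.ofRealHom) z := by
      rw [← hmap]
      exact hroot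
    rw [hchar, Polynomial.map_prod, Polynomial.IsRoot, Polynomial.eval_prod,
      Finset.prod_eq_zero_iff] at hroot'
    obtain ⟨α, -, hα⟩ := hroot'
    rw [Polynomial.map_pow, Polynomial.eval_pow] at hα
    have hα' := eq_zero_of_pow_eq_zero hα
    simp only [Polynomial.map_sub, Polynomial.map_X, Polynomial.map_C, Polynomial.eval_sub,
      Polynomial.eval_X, Polynomial.eval_C, sub_eq_zero] at hα'
    exact ⟨α, hα'⟩
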